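/- Let $V$ be a finite set of $n$ vertices. A weighted correlation clustering instance $G=(V,E^+\uplus E^-,w)$ consists of a partition of the set $E$ of all unordered pairs of distinct vertices into positive edges $E^+$ and negative edges $E^-$, and of weights $w_e\ge 0$ for $e\in E$; let $W=\sum_{e\in E} w_e$ be its total weight. A clustering $\mathcal C$ is a partition of $V$. Put $\sigma_{\mathcal C}(e)=0$ if both endpoints of $e$ lie in the same cluster of $\mathcal C$ and $\sigma_{\mathcal C}(e)=1$ otherwise. The cost of $\mathcal C$ is $$\mathrm{obj}_G(\mathcal C)=\sum_{e\in E^+}w_e\,\sigma_{\mathcal C}(e)+\sum_{e\in E^-}w_e\,(1-\sigma_{\mathcal C}(e)).$$ For a weighted subgraph $H=(V,E_H,w_H)$, with $E_H\subseteq E$ and signs inherited from $G$, the cost is $$\mathrm{obj}_H(\mathcal C)=\sum_{e\in E_H\cap E^+}w_H(e)\,\sigma_{\mathcal C}(e)+\sum_{e\in E_H\cap E^-}w_H(e)\,(1-\sigma_{\mathcal C}(e)).$$ $H$ is an additive $\varepsilon$-edge coreset of $G$ if $|\mathrm{obj}_H(\mathcal C)-\mathrm{obj}_G(\mathcal C)|\le\varepsilon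 W$ for every clustering $\mathcal C$ of $V$. **Theorem.** For every $\varepsilon_0\in(0,1)$ there is a constant $c>0$, depending only on $\varepsilon_0$, such that the following holds. (1) Let $G$ be a weighted correlation clustering instance with $n$ vertices and total weight $W>0$, let $0<\varepsilon\le\varepsilon_0$ and $0<\delta<1$, and let $m$ be a natural number with $$m\ \ge\ c\cdot\frac{(n-1)\log(1/\varepsilon)+\log(1/\delta)}{\varepsilon^2}.$$ Let $H$ be obtained by sampling $m$ edges independently, each equal to $e$ with probability $p(e)=w_e/W$, and assigning weight $W/m$ to each sampled edge, summing weights over repeats. Then $H$ is an additive $\varepsilon$-edge coreset of $G$ with probability at least $1-\delta$. (2) This sample size is $\tilde O(n/\varepsilon^2)$: there are constants $C$ and $k\in\mathbb N$ such that, for all $n\ge 2$, $0<\varepsilon\le\varepsilon_0$ and $0<\delta<1$, $$\left\lceil c\cdot\frac{(n-1)\log(1/\varepsilon)+\log(1/\delta)}{\varepsilon^2}\right\rceil\ \le\ C\,\frac{n}{\varepsilon^2}\bigl(1+\log n+\log(1/\varepsilon)+\log(1/\delta)\bigr)^k .$$ -/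

import Mathlib

namespace CorrelationClustering

/-- The edges of the complete graph on `V`: unordered pairs of distinct vertices. -/
def Edge (V : Type*) : Type _ := {e : Sym2 V // ¬ e.IsDiag}

instance instFintypeEdge {V : Type*} [Fintype V] [DecidableEq V] : Fintype (Edge V) :=
  inferInstanceAs (Fintype {e : Sym2 V // ¬ e.IsDiag})

instance instDecidableEqEdge {V : Type*} [DecidableEq V] : DecidableEq (Edge V) :=
  inferInstanceAs (DecidableEq {e : Sym2 V // ¬ e.IsDiag})

/-- The discrete σ-algebra on the finite set of edges. -/
instance instMeasurableSpaceEdge {V : Type*} : MeasurableSpace (Edge V) := ⊤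

/-- A clustering is a partition of the vertex set into nonempty clusters. -/
abbrev Clustering (V : Type*) [Fintype V] [DecidableEq V] : Type _ :=
  Finpartition (Finset.univ : Finset V)

/-- `sep 𝒞 e` is `0` if the endpoints of `e` lie in the same cluster of `𝒞`, and `1` otherwise. -/
def sep {V : Type*} [Fintype V] [DecidableEq V] (𝒞 : Clustering V) (e : Edge V) : ℝ :=
  Sym2.lift ⟨fun u v => if 𝒞.part u = 𝒞.part v then (0 : ℝ) else 1,
    fun u v => by simp only [eq_comm]⟩ e.val

/-- A weighted correlation clustering instance on the complete graph on `V`: each edge is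
either positive or negative, and carries a nonnegative weight. -/
structure Instance (V : Type*) where
  /-- the set of positive edges -/
  pos : Finset (Edge V)
  /-- the edge weights -/
  weight : Edge V → ℝ
  weight_nonneg : ∀ e, 0 ≤ weight e

/-- A weighted subgraph of the complete graph, on the same vertices; only the weights of its own
edges matter. -/
structure WeightedSubgraph (V : Type*) where
  /-- the edges of the subgraph -/
  edges : Finset (Edge V)
  /-- the edge weights -/
  weight : Edge V → ℝ
  weight_nonneg : ∀ e ∈ edges, 0 ≤ weight e

namespace Instance

variable {V : Type*} [Fintype V] [DecidableEq V]

/-- The set of negative edges. -/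
def neg (G : Instance V) : Finset (Edge V) := G.posᶜ

/-- The total weight `W`. -/
def totalWeight (G : Instance V) : ℝ := ∑ e, G.weight e

/-- The cost of a clustering: the weight of the positive edges that it cuts plus the weight of the
negative edges that it leaves inside clusters. -/
def cost (G : Instance V) (𝒞 : Clustering V) : ℝ :=
  ∑ e ∈ G.pos, G.weight e * sep 𝒞 e + ∑ e ∈ G.neg, G.weight e * (1 - sep 𝒞 e)

/-- The cost of a clustering in a weighted subgraph, whose edges inherit their signs from `G`. -/
def subgraphCost (G : Instance V) (H : WeightedSubgraph V) (𝒞 : Clustering V) : ℝ :=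
  ∑ e ∈ H.edges ∩ G.pos, H.weight e * sep 𝒞 e
    + ∑ e ∈ H.edges ∩ G.neg, H.weight e * (1 - sep 𝒞 e)

/-- `H` preserves the cost of every clustering up to an additive error of `ε W`. -/
def IsAdditiveEdgeCoreset (G : Instance V) (ε : ℝ) (H : WeightedSubgraph V) : Prop :=
  ∀ 𝒞 : Clustering V, |G.subgraphCost H 𝒞 - G.cost 𝒞| ≤ ε * G.totalWeight

/-- The total weight is nonnegative. -/
theorem totalWeight_nonneg (G : Instance V) : 0 ≤ G.totalWeight :=
  Finset.sum_nonneg fun e _ => G.weight_nonneg e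

/-- The weighted subgraph `H` obtained from the sampled edges `s 0, …, s (m - 1)`: every sample
contributes weight `W / m` to its edge, weights being summed over repeats. -/
noncomputable def sampledSubgraph (G : Instance V) {m : ℕ} (s : Fin m → Edge V) :
    WeightedSubgraph V where
  edges := Finset.univ.image s
  weight e := ∑ i with s i = e, G.totalWeight / m
  weight_nonneg _ _ := Finset.sum_nonneg fun _ _ =>
    div_nonneg G.totalWeight_nonneg (Nat.cast_nonneg m)

/-- The distribution on edges that picks `e` with probability `w e / W`. -/
noncomputable def edgePMF (G : Instance V) (hW : 0 < G.totalWeight) : PMF (Edge V) :=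
  PMF.ofFintype (fun e => ENNReal.ofReal (G.weight e / G.totalWeight)) (by
    rw [← ENNReal.ofReal_sum_of_nonneg fun e _ => div_nonneg (G.weight_nonneg e) hW.le,
      ← Finset.sum_div, ← totalWeight, div_self hW.ne', ENNReal.ofReal_one])

/-- The law of `m` independent edges, each with distribution `w e / W`. -/
noncomputable def sampleLaw (G : Instance V) (hW : 0 < G.totalWeight) (m : ℕ) :
    MeasureTheory.Measure (Fin m → Edge V) :=
  MeasureTheory.Measure.pi fun _ => (G.edgePMF hW).toMeasure

end Instance

/-- The sample size `c ((n - 1) log (1/ε) + log (1/δ)) / ε²`. -/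
noncomputable def sampleBound (c : ℝ) (n : ℕ) (ε δ : ℝ) : ℝ :=
  c * ((((n : ℝ) - 1) * Real.log (1 / ε) + Real.log (1 / δ)) / ε ^ 2)

end CorrelationClustering

/-!
The empirical cost of every clustering must be within `ε W` of its true cost, uniformly over all
clusterings. A union bound over the clusterings themselves would cost a factor `log n`; instead
the clusterings are treated as a class of functions on edges that has few traces on any sample.

*Few traces* (`card_lt_of_shatters_cutTraces`, `pow_mul_card_cutTraces_le`). If every subset of an
edge set `T` is the set of edges of `T` cut by some clustering, then `T` is a forest, so
`#T ≤ n - 1`: for each `e ∈ T` some clustering cuts `e` and no other edge of `T`,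
and the indicator of a cluster at an endpoint of `e` is a functional over `ZMod 2` that separates the incidence vector of `e` from
those of the other edges. Pajor's form of the Sauer–Shelah lemma then bounds the number of traces on
`2 m` edges by `x ^ (1 - n) * (1 + x) ^ (2 m)` for every `0 < x ≤ 1`.

*Uniform deviation* (`sum_prob_deviation_le`). By Jensen's inequality the mean may be replaced by
a second independent sample inside the exponential moment. Swapping the two entries of any pair
preserves the law of the double sample, so the differences may be given random signs, and
averaging over the signs bounds the exponential moment of each trace as in Hoeffding's lemma. With
`N` traces, the probability of an upward deviation by more than `ε` is at most
`N * exp (-m ε² / 2)`; negating the losses handles downward deviations.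

*Sample size* (`Instance.prob_coreset_ge`). With `x = ε² / 8` the factor `(1 + x) ^ (2 m)` is at
most `exp (m ε² / 4)`, so the failure probability is at most
`2 (8 / ε²) ^ (n - 1) exp (-m ε² / 4)`. Since `log (1 / ε)` is at least `log (1 / ε₀) > 0` and
`n - 1 ≥ 1`, all additive constants are absorbed into `c`, which depends on `ε₀` alone.
-/

namespace CorrelationClustering

open Finset

/-! ### Uniform deviations by symmetrization -/

section Symmetrization

variable {α ι : Type*} {m : ℕ}

open scoped Classical in
/-- The difference vectors `k ↦ f i (z k).1 - f i (z k).2` that the functions of the family `f`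
produce on the double sample `z`. Functions that agree on the double sample are counted once. -/
noncomputable def diffVectors [Fintype ι] (f : ι → α → ℝ) (z : Fin m → α × α) : Finset (Fin m → ℝ) :=
  univ.image fun i k => f i (z k).1 - f i (z k).2

/-- The sign attached to a swap (`true`) or a non-swap (`false`) of a pair. -/
def swapSign (b : Bool) : ℝ := if b then -1 else 1

/-- Exchange the two entries of the pairs marked by `σ`. -/
def swapPairs (σ : Fin m → Bool) : (Fin m → α × α) ≃ (Fin m → α × α) :=
  Equiv.piCongrRight fun k => if σ k then Equiv.prodComm α α else Equiv.refl _

theorem swapPairs_sub (σ : Fin m → Bool) (z : Fin m → α × α) (g : α → ℝ) (k : Fin m) :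
    g (swapPairs σ z k).1 - g (swapPairs σ z k).2 =
      swapSign (σ k) * (g (z k).1 - g (z k).2) := by
  cases h : σ k <;> simp [swapPairs, swapSign, h]

theorem swapPairs_mul (σ : Fin m → Bool) (z : Fin m → α × α) (p : α → ℝ) (k : Fin m) :
    p (swapPairs σ z k).1 * p (swapPairs σ z k).2 = p (z k).1 * p (z k).2 := by
  cases h : σ k <;> simp [swapPairs, h, mul_comm]

theorem sum_diffVectors_swapPairs [Fintype ι] (f : ι → α → ℝ) (σ : Fin m → Bool) (z : Fin m → α × α)
    (F : (Fin m → ℝ) → ℝ) :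
    ∑ d ∈ diffVectors f (swapPairs σ z), F d =
      ∑ d ∈ diffVectors f z, F fun k => swapSign (σ k) * d k := by
  classical
  have hinj : Function.Injective fun (d : Fin m → ℝ) k => swapSign (σ k) * d k := by
    intro d d' h
    funext k
    have hk := congrFun h k
    have h0 : swapSign (σ k) ≠ 0 := by unfold swapSign; split_ifs <;> norm_num
    exact mul_left_cancel₀ h0 hk
  have himg : diffVectors f (swapPairs σ z) =
      (diffVectors f z).image fun d k => swapSign (σ k) * d k := by
    unfold diffVectors
    rw [image_image]
    refine image_congr fun i _ => ?_
    funext k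
    exact swapPairs_sub σ z (f i) k
  rw [himg, sum_image hinj.injOn]

/-- The exponential moment of a Rademacher sum with coefficients in `[-1, 1]`. -/
theorem sum_exp_swapSign_le (d : Fin m → ℝ) (hd : ∀ k, |d k| ≤ 1) (l : ℝ) :
    ∑ σ : Fin m → Bool, Real.exp (l * ∑ k, swapSign (σ k) * d k) ≤
      2 ^ m * Real.exp (m * l ^ 2 / 2) := by
  have h1 : ∑ σ : Fin m → Bool, Real.exp (l * ∑ k, swapSign (σ k) * d k) =
      ∏ k, (2 * Real.cosh (l * d k)) := by
    have : ∀ k, 2 * Real.cosh (l * d k) = ∑ b : Bool, Real.exp (l * (swapSign b * d k)) := by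
      intro k
      simp [Real.cosh_eq, swapSign]
      ring
    simp_rw [this, prod_univ_sum, Fintype.piFinset_univ, mul_sum, Real.exp_sum]
  rw [h1]
  calc ∏ k, (2 * Real.cosh (l * d k)) ≤ ∏ _k : Fin m, (2 * Real.exp (l ^ 2 / 2)) := by
        refine prod_le_prod (fun k _ => by positivity) fun k _ => ?_
        have h2 : (l * d k) ^ 2 ≤ l ^ 2 := by
          rw [mul_pow]
          exact mul_le_of_le_one_right (sq_nonneg l) ((sq_le_one_iff_abs_le_one _).2 (hd k))
        gcongr
        exact (Real.cosh_le_exp_half_sq _).trans (by gcongr)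
    _ = 2 ^ m * Real.exp (m * l ^ 2 / 2) := by
        rw [prod_const, card_univ, Fintype.card_fin, mul_pow, ← Real.exp_nat_mul]
        ring_nf

/-- Symmetrization: the law of a double sample is invariant under swaps within pairs, so the
difference vectors may be given random signs, and each of them then contributes only the
exponential moment of a Rademacher sum. -/
theorem sum_exp_diffVectors_le [Fintype α] [Fintype ι] (p : α → ℝ) (hp : ∀ a, 0 ≤ p a) (hp1 : ∑ a, p a = 1)
    (f : ι → α → ℝ) (hf : ∀ i a b, |f i a - f i b| ≤ 1) (N : ℝ)
    (hN : ∀ z : Fin m → α × α, (#(diffVectors f z) : ℝ) ≤ N) (l : ℝ) :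
    ∑ z : Fin m → α × α, (∏ k, p (z k).1 * p (z k).2) *
      ∑ d ∈ diffVectors f z, Real.exp (l * ∑ k, d k) ≤ N * Real.exp (m * l ^ 2 / 2) := by
  set S := ∑ z : Fin m → α × α, (∏ k, p (z k).1 * p (z k).2) *
      ∑ d ∈ diffVectors f z, Real.exp (l * ∑ k, d k) with hS
  have hswap : ∀ σ : Fin m → Bool, S = ∑ z : Fin m → α × α, (∏ k, p (z k).1 * p (z k).2) *
      ∑ d ∈ diffVectors f z, Real.exp (l * ∑ k, swapSign (σ k) * d k) := by
    intro σ
    rw [hS, ← Equiv.sum_comp (swapPairs σ)]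
    refine sum_congr rfl fun z _ => ?_
    rw [sum_diffVectors_swapPairs, prod_congr rfl fun k _ => swapPairs_mul σ z p k]
  have htotal : ∑ z : Fin m → α × α, ∏ k, p (z k).1 * p (z k).2 = 1 := by
    have : ∏ _k : Fin m, ∑ x : α × α, p x.1 * p x.2 = 1 := by
      simp_rw [Fintype.sum_prod_type, ← mul_sum, hp1, mul_one, hp1, prod_const_one]
    rw [prod_univ_sum, Fintype.piFinset_univ] at this
    exact this
  have h2 : (2 : ℝ) ^ m * S ≤ 2 ^ m * (N * Real.exp (m * l ^ 2 / 2)) := by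
    calc (2 : ℝ) ^ m * S = ∑ _σ : Fin m → Bool, S := by simp
      _ = ∑ z : Fin m → α × α, (∏ k, p (z k).1 * p (z k).2) *
          ∑ d ∈ diffVectors f z, ∑ σ : Fin m → Bool,
            Real.exp (l * ∑ k, swapSign (σ k) * d k) := by
        rw [sum_congr rfl fun σ _ => hswap σ, sum_comm]
        refine sum_congr rfl fun z _ => ?_
        rw [← mul_sum, sum_comm]
      _ ≤ ∑ z : Fin m → α × α, (∏ k, p (z k).1 * p (z k).2) *
          (N * (2 ^ m * Real.exp (m * l ^ 2 / 2))) := by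
        refine sum_le_sum fun z _ => mul_le_mul_of_nonneg_left ?_
          (prod_nonneg fun k _ => mul_nonneg (hp _) (hp _))
        calc _ ≤ ∑ _d ∈ diffVectors f z, 2 ^ m * Real.exp (m * l ^ 2 / 2) := by
              refine sum_le_sum fun d hd => sum_exp_swapSign_le d ?_ l
              simp only [diffVectors, mem_image, mem_univ, true_and] at hd
              obtain ⟨i, rfl⟩ := hd
              exact fun k => hf i _ _
          _ = #(diffVectors f z) * (2 ^ m * Real.exp (m * l ^ 2 / 2)) := by
              rw [sum_const, nsmul_eq_mul]
          _ ≤ _ := mul_le_mul_of_nonneg_right (hN z) (by positivity)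
      _ = 2 ^ m * (N * Real.exp (m * l ^ 2 / 2)) := by
        rw [← sum_mul, htotal]
        ring
  exact le_of_mul_le_mul_left h2 (by positivity)

/-- Jensen's inequality, coordinate by coordinate: the mean of `g` may be replaced by the values
of `g` on a second independent sample. -/
theorem exp_sum_sub_mean_le [Fintype α] (p : α → ℝ) (hp : ∀ a, 0 ≤ p a) (hp1 : ∑ a, p a = 1)
    (g : α → ℝ) (s : Fin m → α) (l : ℝ) :
    Real.exp (l * ∑ k, (g (s k) - ∑ a, p a * g a)) ≤
      ∑ t : Fin m → α, (∏ k, p (t k)) * Real.exp (l * ∑ k, (g (s k) - g (t k))) := by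
  have h1 : ∀ k, Real.exp (l * (g (s k) - ∑ a, p a * g a)) ≤
      ∑ a, p a * Real.exp (l * (g (s k) - g a)) := by
    intro k
    have h := convexOn_exp.map_sum_le (t := univ) (w := p) (p := fun a => l * (g (s k) - g a))
      (fun a _ => hp a) hp1 (fun a _ => Set.mem_univ _)
    simp only [smul_eq_mul] at h
    refine le_trans (le_of_eq ?_) h
    congr 1
    have h3 : ∀ a, p a * (l * (g (s k) - g a)) = p a * (l * g (s k)) - l * (p a * g a) := by
      intro a; ring
    simp_rw [h3, sum_sub_distrib, ← sum_mul, ← mul_sum, hp1]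
    ring
  calc _ = ∏ k, Real.exp (l * (g (s k) - ∑ a, p a * g a)) := by rw [mul_sum, Real.exp_sum]
    _ ≤ ∏ k, ∑ a, p a * Real.exp (l * (g (s k) - g a)) :=
        prod_le_prod (fun k _ => (Real.exp_pos _).le) fun k _ => h1 k
    _ = _ := by
        rw [prod_univ_sum, Fintype.piFinset_univ]
        refine sum_congr rfl fun t _ => ?_
        rw [prod_mul_distrib, mul_sum, Real.exp_sum]

/-- One-sided uniform deviation bound: if the family `f` has at most `N` traces on every double
sample, the probability that some empirical sum exceeds its mean by more than `m * ε` is at most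
`N * exp (-m ε² / 2)`. -/
theorem sum_prob_deviation_le [Fintype α] [Fintype ι] (p : α → ℝ) (hp : ∀ a, 0 ≤ p a) (hp1 : ∑ a, p a = 1)
    (f : ι → α → ℝ) (hf : ∀ i a b, |f i a - f i b| ≤ 1) (N : ℝ)
    (hN : ∀ z : Fin m → α × α, (#(diffVectors f z) : ℝ) ≤ N) (ε : ℝ) (hε : 0 < ε)
    (B : Finset (Fin m → α))
    (hB : ∀ s ∈ B, ∃ i, m * ε < ∑ k, (f i (s k) - ∑ a, p a * f i a)) :
    ∑ s ∈ B, ∏ k, p (s k) ≤ N * Real.exp (-(m * ε ^ 2 / 2)) := by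
  classical
  -- The Chernoff parameter `ε` minimises `m l² / 2 - l m ε`.
  let Φ : (Fin m → α) → (Fin m → α) → ℝ := fun s t =>
    ∑ d ∈ diffVectors f (fun k => (s k, t k)), Real.exp (ε * ∑ k, d k)
  have hq : ∀ s : Fin m → α, 0 ≤ ∏ k, p (s k) := fun s => prod_nonneg fun k _ => hp _
  have hΦ0 : ∀ s t, 0 ≤ Φ s t := fun s t => sum_nonneg fun d _ => (Real.exp_pos _).le
  have hbad : ∀ s ∈ B, 1 ≤ Real.exp (-(ε * (m * ε))) * ∑ t, (∏ k, p (t k)) * Φ s t := by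
    intro s hs
    obtain ⟨i, hi⟩ := hB s hs
    calc (1 : ℝ) ≤ Real.exp (-(ε * (m * ε)) + ε * ∑ k, (f i (s k) - ∑ a, p a * f i a)) := by
          rw [Real.one_le_exp_iff]
          nlinarith
      _ ≤ _ := by
          rw [Real.exp_add]
          refine mul_le_mul_of_nonneg_left ?_ (Real.exp_pos _).le
          refine (exp_sum_sub_mean_le p hp hp1 (f i) s ε).trans ?_
          refine sum_le_sum fun t _ => mul_le_mul_of_nonneg_left ?_ (hq t)
          refine single_le_sum (f := fun d : Fin m → ℝ => Real.exp (ε * ∑ k, d k))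
            (fun d _ => (Real.exp_pos _).le)
            (a := fun k => f i (s k) - f i (t k)) ?_
          simp only [diffVectors, mem_image, mem_univ, true_and]
          exact ⟨i, rfl⟩
  have hdouble : ∑ s : Fin m → α, (∏ k, p (s k)) * ∑ t, (∏ k, p (t k)) * Φ s t =
      ∑ z : Fin m → α × α, (∏ k, p (z k).1 * p (z k).2) *
        ∑ d ∈ diffVectors f z, Real.exp (ε * ∑ k, d k) := by
    rw [← Equiv.sum_comp (Equiv.arrowProdEquivProdArrow (Fin m) (fun _ => α) (fun _ => α)).symm,
      Fintype.sum_prod_type]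
    refine sum_congr rfl fun s _ => ?_
    rw [mul_sum]
    refine sum_congr rfl fun t _ => ?_
    rw [← mul_assoc, ← prod_mul_distrib]
    rfl
  calc ∑ s ∈ B, ∏ k, p (s k)
      ≤ ∑ s ∈ B, (∏ k, p (s k)) *
          (Real.exp (-(ε * (m * ε))) * ∑ t, (∏ k, p (t k)) * Φ s t) :=
        sum_le_sum fun s hs => le_mul_of_one_le_right (hq s) (hbad s hs)
    _ ≤ ∑ s : Fin m → α, (∏ k, p (s k)) *
          (Real.exp (-(ε * (m * ε))) * ∑ t, (∏ k, p (t k)) * Φ s t) :=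
        sum_le_sum_of_subset_of_nonneg (subset_univ _) fun s _ _ =>
          mul_nonneg (hq s) (mul_nonneg (Real.exp_pos _).le
            (sum_nonneg fun t _ => mul_nonneg (hq t) (hΦ0 s t)))
    _ = Real.exp (-(ε * (m * ε))) *
          ∑ s : Fin m → α, (∏ k, p (s k)) * ∑ t, (∏ k, p (t k)) * Φ s t := by
        rw [mul_sum]
        exact sum_congr rfl fun s _ => by ring
    _ ≤ Real.exp (-(ε * (m * ε))) * (N * Real.exp (m * ε ^ 2 / 2)) := by
        rw [hdouble]
        exact mul_le_mul_of_nonneg_left (sum_exp_diffVectors_le p hp hp1 f hf N hN ε)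
          (Real.exp_pos _).le
    _ = N * Real.exp (-(m * ε ^ 2 / 2)) := by
        rw [mul_left_comm, ← Real.exp_add]
        ring_nf

end Symmetrization

/-! ### Traces of clusterings on edge sets -/

section GraphicMatroid

variable {V : Type*} [DecidableEq V]

/-- The incidence vector of an edge. Over `ZMod 2` no orientation of the edge is needed. -/
def incidenceVec (e : Edge V) : V → ZMod 2 := fun v => if v ∈ e.val then 1 else 0

theorem sum_incidenceVec_mk {u v : V} (h : ¬ (s(u, v) : Sym2 V).IsDiag) (P : Finset V) :
    ∑ x ∈ P, incidenceVec ⟨s(u, v), h⟩ x =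
      (if u ∈ P then 1 else 0) + (if v ∈ P then 1 else 0) := by
  have huv : u ≠ v := by simpa using h
  have hx : ∀ x, incidenceVec ⟨s(u, v), h⟩ x =
      (if x = u then (1 : ZMod 2) else 0) + (if x = v then 1 else 0) := by
    intro x
    simp only [incidenceVec, Sym2.mem_iff]
    by_cases h1 : x = u <;> by_cases h2 : x = v <;> simp_all
  simp_rw [hx, sum_add_distrib, Finset.sum_ite_eq']

variable [Fintype V]

theorem sum_incidenceVec (e : Edge V) : ∑ x, incidenceVec e x = 0 := by
  obtain ⟨e, he⟩ := e
  induction e with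
  | _ u v =>
    rw [sum_incidenceVec_mk]
    simp only [mem_univ, if_true]
    decide

/-- An edge inside a cluster of `𝒞` meets every cluster in an even number of endpoints. -/
theorem sum_part_incidenceVec_of_sep_eq_zero (𝒞 : Clustering V) {e : Edge V}
    (h0 : sep 𝒞 e = 0) (a : V) : ∑ x ∈ 𝒞.part a, incidenceVec e x = 0 := by
  obtain ⟨e, he⟩ := e
  induction e with
  | _ u v =>
    have h : 𝒞.part u = 𝒞.part v := by
      by_contra hne
      simp [sep, hne] at h0
    rw [sum_incidenceVec_mk]
    simp only [𝒞.mem_part_iff_part_eq_part (mem_univ _) (mem_univ _), h]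
    split_ifs <;> decide

/-- An edge cut by `𝒞` has exactly one endpoint in the cluster of one of its endpoints. -/
theorem exists_sum_part_incidenceVec_of_sep_ne_zero (𝒞 : Clustering V) {e : Edge V}
    (h0 : sep 𝒞 e ≠ 0) : ∃ a, ∑ x ∈ 𝒞.part a, incidenceVec e x = 1 := by
  obtain ⟨e, he⟩ := e
  induction e with
  | _ u v =>
    have h : 𝒞.part v ≠ 𝒞.part u := by
      intro heq
      simp [sep, heq] at h0
    refine ⟨u, ?_⟩
    rw [sum_incidenceVec_mk]
    simp [𝒞.mem_part_iff_part_eq_part (mem_univ _) (mem_univ _), h]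

open scoped Classical in
/-- The sets of edges of `S` that can be cut by a clustering: the traces on `S` of all
clusterings. -/
noncomputable def cutTraces (S : Finset (Edge V)) : Finset (Finset (Edge V)) :=
  univ.image fun 𝒞 : Clustering V => S.filter fun e => sep 𝒞 e ≠ 0

/-- A shattered set of edges is a forest: each of its edges can be cut while all others stay
inside clusters, which makes the incidence vectors linearly independent. Adding a unit vector keeps
them independent, because incidence vectors have coordinate sum zero. -/
theorem card_lt_of_shatters_cutTraces [Nonempty V] {S T : Finset (Edge V)}
    (hT : (cutTraces S).Shatters T) : #T < Fintype.card V := by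
  classical
  have hind : LinearIndependent (ZMod 2) fun e : T => incidenceVec e.1 := by
    rw [Fintype.linearIndependent_iff]
    intro g hg e
    obtain ⟨U, hU, hTU⟩ := hT.exists_inter_eq_singleton e.2
    simp only [cutTraces, mem_image, mem_univ, true_and] at hU
    obtain ⟨𝒞, rfl⟩ := hU
    obtain ⟨U', hU', hTU'⟩ := hT.exists_superset
    have hTS : T ⊆ S := by
      simp only [cutTraces, mem_image, mem_univ, true_and] at hU'
      obtain ⟨𝒞', rfl⟩ := hU'
      exact hTU'.trans (filter_subset _ _)
    have hcut : ∀ e' ∈ T, sep 𝒞 e' ≠ 0 ↔ e' = e := by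
      intro e' he'
      have := congrArg (e' ∈ ·) hTU
      simpa [he', hTS he'] using this
    obtain ⟨a, ha⟩ := exists_sum_part_incidenceVec_of_sep_ne_zero 𝒞 ((hcut e e.2).2 rfl)
    have hsum : ∑ x ∈ 𝒞.part a, (∑ e' : T, g e' • incidenceVec e'.1) x = 0 := by
      rw [hg]; simp
    simp only [Finset.sum_apply, Pi.smul_apply, smul_eq_mul] at hsum
    rw [sum_comm] at hsum
    simp_rw [← mul_sum] at hsum
    rw [sum_eq_single e] at hsum
    · simpa [ha] using hsum
    · intro e' _ hne
      have h0 : sep 𝒞 e'.1 = 0 := by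
        by_contra h
        exact hne (Subtype.ext ((hcut e' e'.2).1 h))
      rw [sum_part_incidenceVec_of_sep_eq_zero 𝒞 h0, mul_zero]
    · simp
  obtain ⟨r⟩ := ‹Nonempty V›
  let total : (V → ZMod 2) →ₗ[ZMod 2] ZMod 2 := ∑ x, LinearMap.proj x
  have htotal : ∀ y, total y = ∑ x, y x := fun y => by simp [total]
  have hr : (Pi.single r 1 : V → ZMod 2) ∉
      Submodule.span (ZMod 2) (Set.range fun e : T => incidenceVec e.1) := by
    intro hmem
    have hle : Submodule.span (ZMod 2) (Set.range fun e : T => incidenceVec e.1) ≤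
        LinearMap.ker total := by
      rw [Submodule.span_le]
      rintro _ ⟨e, rfl⟩
      simp [htotal, sum_incidenceVec]
    have := hle hmem
    simp [htotal] at this
  have hcard := (linearIndependent_option'.2 ⟨hind, hr⟩).fintype_card_le_finrank
  simp only [Fintype.card_option, Fintype.card_coe, Module.finrank_pi] at hcard
  omega

/-- A Sauer–Shelah bound in generating-function form: the clusterings have at most
`x ^ (1 - n) * (1 + x) ^ #S` traces on a set `S` of edges. -/
theorem pow_mul_card_cutTraces_le [Nonempty V] (S : Finset (Edge V)) {x : ℝ} (hx : 0 < x)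
    (hx1 : x ≤ 1) :
    x ^ (Fintype.card V - 1) * #(cutTraces S) ≤ (1 + x) ^ #S := by
  have hsub : (cutTraces S).shatterer ⊆ S.powerset := by
    intro T hT
    rw [mem_shatterer] at hT
    obtain ⟨U, hU, hTU⟩ := hT.exists_superset
    simp only [cutTraces, mem_image, mem_univ, true_and] at hU
    obtain ⟨𝒞, rfl⟩ := hU
    exact mem_powerset.2 (hTU.trans (filter_subset _ _))
  calc x ^ (Fintype.card V - 1) * #(cutTraces S)
      ≤ x ^ (Fintype.card V - 1) * #(cutTraces S).shatterer := by
        exact mul_le_mul_of_nonneg_left (mod_cast card_le_card_shatterer (cutTraces S))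
          (by positivity)
    _ = ∑ _T ∈ (cutTraces S).shatterer, x ^ (Fintype.card V - 1) := by
        rw [sum_const, nsmul_eq_mul, mul_comm]
    _ ≤ ∑ T ∈ (cutTraces S).shatterer, x ^ #T := by
        refine sum_le_sum fun T hT => pow_le_pow_of_le_one hx.le hx1 ?_
        have := card_lt_of_shatters_cutTraces (mem_shatterer.1 hT)
        omega
    _ ≤ ∑ T ∈ S.powerset, x ^ #T :=
        sum_le_sum_of_subset_of_nonneg hsub fun T _ _ => by positivity
    _ = (1 + x) ^ #S := by
        rw [add_comm, ← sum_pow_mul_eq_add_pow]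
        simp

end GraphicMatroid

/-! ### Losses of clusterings on sampled edges -/

namespace Instance

section Sampling

variable {V : Type*} [Fintype V] [DecidableEq V]

/-- The cost that a unit of weight on the edge `e` incurs under the clustering `𝒞`. -/
noncomputable def loss (G : Instance V) (𝒞 : Clustering V) (e : Edge V) : ℝ :=
  if e ∈ G.pos then sep 𝒞 e else 1 - sep 𝒞 e

theorem sep_eq_zero_or_one (𝒞 : Clustering V) (e : Edge V) :
    sep 𝒞 e = 0 ∨ sep 𝒞 e = 1 := by
  obtain ⟨e, he⟩ := e
  induction e with
  | _ u v =>
    by_cases h : 𝒞.part u = 𝒞.part v <;> simp [sep, h]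

theorem abs_loss_sub_loss_le (G : Instance V) (𝒞 : Clustering V) (e e' : Edge V) :
    |G.loss 𝒞 e - G.loss 𝒞 e'| ≤ 1 := by
  unfold loss
  rcases sep_eq_zero_or_one 𝒞 e with h | h <;> rcases sep_eq_zero_or_one 𝒞 e' with h' | h' <;>
    split_ifs <;> norm_num [h, h']

theorem cost_eq (G : Instance V) (𝒞 : Clustering V) :
    G.cost 𝒞 = ∑ e, G.weight e * G.loss 𝒞 e := by
  unfold cost neg loss
  rw [← sum_add_sum_compl G.pos]
  congr 1
  · exact sum_congr rfl fun e he => by rw [if_pos he]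
  · exact sum_congr rfl fun e he => by rw [if_neg (mem_compl.1 he)]

theorem subgraphCost_sampledSubgraph (G : Instance V) {m : ℕ} (s : Fin m → Edge V)
    (𝒞 : Clustering V) :
    G.subgraphCost (G.sampledSubgraph s) 𝒞 = G.totalWeight / m * ∑ k, G.loss 𝒞 (s k) := by
  have h1 : G.subgraphCost (G.sampledSubgraph s) 𝒞 =
      ∑ e ∈ univ.image s, (∑ k with s k = e, G.totalWeight / m) * G.loss 𝒞 e := by
    unfold subgraphCost neg loss
    rw [← sum_inter_add_sum_sdiff (univ.image s) G.pos, sdiff_eq_inter_compl]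
    congr 1
    · exact sum_congr rfl fun e he => by rw [if_pos (mem_inter.1 he).2]; rfl
    · exact sum_congr rfl fun e he => by
        rw [if_neg (mem_compl.1 (mem_inter.1 he).2)]; rfl
  rw [h1, mul_sum, ← sum_fiberwise_of_maps_to
    (g := s) (t := univ.image s) fun k _ => mem_image_of_mem s (mem_univ k)]
  refine sum_congr rfl fun e _ => ?_
  rw [sum_mul]
  refine sum_congr rfl fun k hk => ?_
  rw [(mem_filter.1 hk).2]

/-- The losses on a double sample of `2 m` edges are determined by the trace of the clustering on
the sampled edges. The factor `c` allows for both signs. -/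
theorem card_diffVectors_loss_le (G : Instance V) [Nonempty V] {m : ℕ} (c : ℝ) {x : ℝ}
    (hx : 0 < x) (hx1 : x ≤ 1) (z : Fin m → Edge V × Edge V) :
    (#(diffVectors (fun (𝒞 : Clustering V) e => c * G.loss 𝒞 e) z) : ℝ) ≤
      (1 / x) ^ (Fintype.card V - 1) * (1 + x) ^ (2 * m) := by
  classical
  let S : Finset (Edge V) := univ.image (fun k => (z k).1) ∪ univ.image (fun k => (z k).2)
  have hS : #S ≤ 2 * m := by
    refine (card_union_le _ _).trans ?_
    have h1 := card_image_le (s := univ) (f := fun k => (z k).1)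
    have h2 := card_image_le (s := univ) (f := fun k => (z k).2)
    simp only [card_univ, Fintype.card_fin] at h1 h2
    omega
  -- The loss of an edge, recovered from the set `U` of cut edges.
  let traceLoss : Finset (Edge V) → Edge V → ℝ := fun U e =>
    if e ∈ G.pos then (if e ∈ U then 1 else 0) else 1 - (if e ∈ U then 1 else 0)
  have hloss : ∀ (𝒞 : Clustering V), ∀ e ∈ S,
      traceLoss (S.filter fun e => sep 𝒞 e ≠ 0) e = G.loss 𝒞 e := by
    intro 𝒞 e he
    rcases sep_eq_zero_or_one 𝒞 e with h | h <;> simp [traceLoss, loss, he, h]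
  have himg : diffVectors (fun (𝒞 : Clustering V) e => c * G.loss 𝒞 e) z =
      (cutTraces S).image
        fun U k => c * traceLoss U (z k).1 - c * traceLoss U (z k).2 := by
    unfold diffVectors cutTraces
    rw [image_image]
    refine image_congr fun 𝒞 _ => ?_
    funext k
    simp only [Function.comp_apply]
    rw [hloss 𝒞 _ (mem_union_left _ (mem_image_of_mem _ (mem_univ k))),
      hloss 𝒞 _ (mem_union_right _ (mem_image_of_mem _ (mem_univ k)))]
  calc (#(diffVectors (fun (𝒞 : Clustering V) e => c * G.loss 𝒞 e) z) : ℝ)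
      ≤ #(cutTraces S) := by
        rw [himg]
        exact_mod_cast card_image_le
    _ ≤ (1 / x) ^ (Fintype.card V - 1) * (1 + x) ^ #S := by
        have h := pow_mul_card_cutTraces_le S hx hx1
        rw [one_div, inv_pow, ← div_eq_inv_mul, le_div_iff₀ (by positivity), mul_comm]
        exact h
    _ ≤ _ := by
        gcongr
        linarith

theorem sampleLaw_real_coe (G : Instance V) (hW : 0 < G.totalWeight) (m : ℕ)
    (B : Finset (Fin m → Edge V)) :
    (G.sampleLaw hW m).real B = ∑ s ∈ B, ∏ k, G.weight (s k) / G.totalWeight := by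
  unfold sampleLaw
  rw [← MeasureTheory.sum_measureReal_singleton]
  refine sum_congr rfl fun s _ => ?_
  rw [MeasureTheory.measureReal_def, MeasureTheory.Measure.pi_singleton, ENNReal.toReal_prod]
  refine prod_congr rfl fun k _ => ?_
  rw [PMF.toMeasure_apply_singleton _ _ (MeasurableSet.singleton _)]
  simp only [edgePMF, PMF.ofFintype_apply]
  exact ENNReal.toReal_ofReal (div_nonneg (G.weight_nonneg _) hW.le)

end Sampling

end Instance

/-! ### The failure probability of the sample -/

namespace Instance

variable {V : Type*} [Fintype V] [DecidableEq V]

theorem one_lt_card (G : Instance V) (hW : 0 < G.totalWeight) : 1 < Fintype.card V := by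
  obtain ⟨⟨e, he⟩, -, -⟩ := exists_ne_zero_of_sum_ne_zero hW.ne'
  induction e with
  | _ u v => exact Fintype.one_lt_card_iff.2 ⟨u, v, by simpa using he⟩

/-- The failure probability, with a free parameter `x` from the bound on the number of traces.
The factor `2` accounts for deviations above and below the mean. -/
theorem prob_not_coreset_le (G : Instance V) (hW : 0 < G.totalWeight) {m : ℕ} (hm : 0 < m)
    {ε x : ℝ} (hε : 0 < ε) (hx : 0 < x) (hx1 : x ≤ 1) :
    (G.sampleLaw hW m).real {s | G.IsAdditiveEdgeCoreset ε (G.sampledSubgraph s)}ᶜ ≤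
      2 * ((1 / x) ^ (Fintype.card V - 1) * (1 + x) ^ (2 * m) *
        Real.exp (-(m * ε ^ 2 / 2))) := by
  classical
  have hV : Nonempty V := Fintype.card_pos_iff.1 (by have := G.one_lt_card hW; omega)
  set W := G.totalWeight with hWdef
  let p : Edge V → ℝ := fun e => G.weight e / W
  let B : ℝ → Finset (Fin m → Edge V) := fun c => univ.filter fun s =>
    ∃ 𝒞 : Clustering V, m * ε < ∑ k, (c * G.loss 𝒞 (s k) - ∑ e, p e * (c * G.loss 𝒞 e))
  have hp : ∀ e, 0 ≤ p e := fun e => div_nonneg (G.weight_nonneg e) hW.le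
  have hp1 : ∑ e, p e = 1 := by
    simp only [p]
    rw [← sum_div, hWdef, totalWeight, div_self]
    exact hW.ne'
  have hB : ∀ c : ℝ, |c| = 1 → (G.sampleLaw hW m).real (B c) ≤
      (1 / x) ^ (Fintype.card V - 1) * (1 + x) ^ (2 * m) * Real.exp (-(m * ε ^ 2 / 2)) := by
    intro c hc
    rw [sampleLaw_real_coe]
    refine sum_prob_deviation_le p hp hp1 (fun (𝒞 : Clustering V) e => c * G.loss 𝒞 e) ?_ _
      (fun z => G.card_diffVectors_loss_le c hx hx1 z) ε hε (B c) ?_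
    · intro 𝒞 e e'
      rw [← mul_sub, abs_mul, hc, one_mul]
      exact G.abs_loss_sub_loss_le 𝒞 e e'
    · intro s hs
      simpa [B] using hs
  have hm' : (0 : ℝ) < m := by exact_mod_cast hm
  have hdev : ∀ (s : Fin m → Edge V) (𝒞 : Clustering V) (c : ℝ),
      c * (G.subgraphCost (G.sampledSubgraph s) 𝒞 - G.cost 𝒞) =
        W / m * ∑ k, (c * G.loss 𝒞 (s k) - ∑ e, p e * (c * G.loss 𝒞 e)) := by
    intro s 𝒞 c
    have hcost : G.cost 𝒞 = W * ∑ e, p e * G.loss 𝒞 e := by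
      rw [cost_eq, mul_sum]
      refine sum_congr rfl fun e _ => ?_
      simp only [p]
      field_simp
    have hpc : ∑ e, p e * (c * G.loss 𝒞 e) = c * ∑ e, p e * G.loss 𝒞 e := by
      rw [mul_sum]
      exact sum_congr rfl fun e _ => by ring
    rw [subgraphCost_sampledSubgraph, hcost, hpc, sum_sub_distrib, ← mul_sum, sum_const,
      card_univ, Fintype.card_fin, nsmul_eq_mul, ← hWdef]
    field_simp
  have hmem : ∀ (s : Fin m → Edge V) (𝒞 : Clustering V) (c : ℝ),
      ε * W < c * (G.subgraphCost (G.sampledSubgraph s) 𝒞 - G.cost 𝒞) → s ∈ B c := by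
    intro s 𝒞 c h
    rw [hdev] at h
    simp only [B, mem_filter, mem_univ, true_and]
    refine ⟨𝒞, ?_⟩
    rw [div_mul_eq_mul_div, lt_div_iff₀ hm'] at h
    nlinarith
  have hsub : {s | G.IsAdditiveEdgeCoreset ε (G.sampledSubgraph s)}ᶜ ⊆
      (B 1 : Set (Fin m → Edge V)) ∪ B (-1) := by
    intro s hs
    simp only [Set.mem_compl_iff, Set.mem_ofPred_eq, IsAdditiveEdgeCoreset, not_forall,
      not_le, lt_abs] at hs
    obtain ⟨𝒞, h | h⟩ := hs
    · exact Or.inl (hmem s 𝒞 1 (by linarith))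
    · exact Or.inr (hmem s 𝒞 (-1) (by linarith))
  have hfin : MeasureTheory.IsProbabilityMeasure (G.sampleLaw hW m) := by
    unfold sampleLaw
    infer_instance
  calc _ ≤ (G.sampleLaw hW m).real ((B 1 : Set (Fin m → Edge V)) ∪ B (-1)) :=
        MeasureTheory.measureReal_mono hsub
    _ ≤ (G.sampleLaw hW m).real (B 1) + (G.sampleLaw hW m).real (B (-1)) :=
        MeasureTheory.measureReal_union_le _ _
    _ ≤ _ := by
        have h1 := hB 1 (by simp)
        have h2 := hB (-1) (by simp)
        linarith

/-- The failure probability with the trace parameter `x = ε² / 8`, for which the factor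
`(1 + x) ^ (2 m)` uses up half of the exponent `m ε² / 2`. -/
theorem prob_coreset_ge (G : Instance V) (hW : 0 < G.totalWeight) {m : ℕ} (hm : 0 < m)
    {ε δ : ℝ} (hε : 0 < ε) (hε1 : ε ≤ 1) (hδ : 0 < δ)
    (h : 4 * (((Fintype.card V : ℝ) - 1) * (Real.log 8 + 2 * Real.log (1 / ε)) +
      (Real.log 2 + Real.log (1 / δ))) ≤ m * ε ^ 2) :
    1 - δ ≤ (G.sampleLaw hW m).real
      {s | G.IsAdditiveEdgeCoreset ε (G.sampledSubgraph s)} := by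
  have hn := G.one_lt_card hW
  have hfin : MeasureTheory.IsProbabilityMeasure (G.sampleLaw hW m) := by
    unfold sampleLaw
    infer_instance
  have hx : 0 < ε ^ 2 / 8 := by positivity
  have hx1 : ε ^ 2 / 8 ≤ 1 := by nlinarith
  have hfail := G.prob_not_coreset_le hW hm hε hx hx1
  rw [MeasureTheory.probReal_compl_eq_one_sub (Set.toFinite _).measurableSet] at hfail
  have hpow : (1 / (ε ^ 2 / 8)) ^ (Fintype.card V - 1) =
      Real.exp (((Fintype.card V : ℝ) - 1) * (Real.log 8 + 2 * Real.log (1 / ε))) := by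
    have h1 : Real.log (1 / (ε ^ 2 / 8)) = Real.log 8 + 2 * Real.log (1 / ε) := by
      rw [one_div_div, Real.log_div (by norm_num) (by positivity), one_div, Real.log_inv,
        Real.log_pow]
      push_cast
      ring
    rw [← h1, ← Nat.cast_pred (by omega), Real.exp_nat_mul, Real.exp_log (by positivity)]
  have hexp : (1 + ε ^ 2 / 8) ^ (2 * m) ≤ Real.exp (m * ε ^ 2 / 4) := by
    calc (1 + ε ^ 2 / 8) ^ (2 * m) ≤ Real.exp (ε ^ 2 / 8) ^ (2 * m) := by
          gcongr
          linarith [Real.add_one_le_exp (ε ^ 2 / 8)]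
      _ = Real.exp (m * ε ^ 2 / 4) := by
          rw [← Real.exp_nat_mul]
          push_cast
          ring_nf
  have hδ' : 2 * ((1 / (ε ^ 2 / 8)) ^ (Fintype.card V - 1) * (1 + ε ^ 2 / 8) ^ (2 * m) *
      Real.exp (-(m * ε ^ 2 / 2))) ≤ δ := by
    rw [hpow]
    calc _ ≤ 2 * (Real.exp (((Fintype.card V : ℝ) - 1) *
          (Real.log 8 + 2 * Real.log (1 / ε))) * Real.exp (m * ε ^ 2 / 4) *
          Real.exp (-(m * ε ^ 2 / 2))) := by gcongr
      _ = Real.exp (Real.log 2 + (((Fintype.card V : ℝ) - 1) *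
          (Real.log 8 + 2 * Real.log (1 / ε)) + m * ε ^ 2 / 4 + -(m * ε ^ 2 / 2))) := by
          rw [Real.exp_add, Real.exp_add, Real.exp_add, Real.exp_log (by norm_num)]
      _ ≤ Real.exp (Real.log δ) := by
          rw [Real.exp_le_exp]
          rw [one_div δ, Real.log_inv] at h
          linarith
      _ = δ := Real.exp_log hδ
  linarith

end Instance

/-! ### The sample size -/

theorem sampleBound_pos {c : ℝ} (hc : 0 < c) {n : ℕ} (hn : 1 < n) {ε δ : ℝ} (hε : 0 < ε)
    (hε1 : ε < 1) (hδ : 0 < δ) (hδ1 : δ < 1) : 0 < sampleBound c n ε δ := by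
  have hn' : (0 : ℝ) < n - 1 := by
    have : (1 : ℝ) < n := by exact_mod_cast hn
    linarith
  have h1 : 0 < Real.log (1 / ε) := Real.log_pos (one_lt_one_div hε hε1)
  have h2 : 0 < Real.log (1 / δ) := Real.log_pos (one_lt_one_div hδ hδ1)
  unfold sampleBound
  positivity

theorem ceil_sampleBound_le {c : ℝ} (hc : 0 < c) {n : ℕ} (hn : 2 ≤ n) {ε δ : ℝ} (hε : 0 < ε)
    (hε1 : ε < 1) (hδ : 0 < δ) (hδ1 : δ < 1) :
    (⌈sampleBound c n ε δ⌉₊ : ℝ) ≤ (c + 1) * ((n : ℝ) / ε ^ 2) *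
      (1 + Real.log n + Real.log (1 / ε) + Real.log (1 / δ)) := by
  have hn' : (1 : ℝ) ≤ n := by exact_mod_cast (by omega : 1 ≤ n)
  have h1 : 0 < Real.log (1 / ε) := Real.log_pos (one_lt_one_div hε hε1)
  have h2 : 0 < Real.log (1 / δ) := Real.log_pos (one_lt_one_div hδ hδ1)
  have h3 : 0 ≤ Real.log n := Real.log_nonneg hn'
  set L := Real.log (1 / ε)
  set D := Real.log (1 / δ)
  have hceil := (Nat.ceil_lt_add_one (sampleBound_pos hc (n := n) (by omega) hε hε1 hδ hδ1).le).le
  have hA : 1 ≤ (n : ℝ) / ε ^ 2 := by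
    rw [one_le_div (by positivity)]
    nlinarith
  have hB : sampleBound c n ε δ ≤ c * ((n : ℝ) / ε ^ 2) * (1 + Real.log n + L + D) := by
    have : ((n : ℝ) - 1) * L + D ≤ n * (1 + Real.log n + L + D) := by
      have h4 : 0 ≤ (n : ℝ) * Real.log n := by positivity
      have h5 : D ≤ n * D := le_mul_of_one_le_left h2.le hn'
      nlinarith
    calc sampleBound c n ε δ ≤ c * ((n * (1 + Real.log n + L + D)) / ε ^ 2) := by
          unfold sampleBound
          gcongr
      _ = _ := by ring
  have hC : 1 ≤ (n : ℝ) / ε ^ 2 * (1 + Real.log n + L + D) :=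
    one_le_mul_of_one_le_of_one_le hA (by linarith)
  linarith

end CorrelationClustering

theorem theorem3p2 (ε₀ : ℝ) (hε₀ : 0 < ε₀) (hε₀' : ε₀ < 1) :
    ∃ c : ℝ, 0 < c ∧
      (∀ (V : Type*) [Fintype V] [DecidableEq V] (G : CorrelationClustering.Instance V)
        (hW : 0 < G.totalWeight) (ε δ : ℝ), 0 < ε → ε ≤ ε₀ → 0 < δ → δ < 1 →
        ∀ m : ℕ, CorrelationClustering.sampleBound c (Fintype.card V) ε δ ≤ (m : ℝ) →
          1 - δ ≤ (G.sampleLaw hW m).real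
            {s | G.IsAdditiveEdgeCoreset ε (G.sampledSubgraph s)}) ∧
      (∃ (C : ℝ) (k : ℕ), ∀ (n : ℕ) (ε δ : ℝ), 2 ≤ n → 0 < ε → ε ≤ ε₀ → 0 < δ → δ < 1 →
        (⌈CorrelationClustering.sampleBound c n ε δ⌉₊ : ℝ) ≤
          C * ((n : ℝ) / ε ^ 2)
            * (1 + Real.log n + Real.log (1 / ε) + Real.log (1 / δ)) ^ k) := by
  have hL0 : 0 < Real.log (1 / ε₀) := Real.log_pos (one_lt_one_div hε₀ hε₀')
  have hl8 : 0 < Real.log 8 := Real.log_pos (by norm_num)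
  have hl2 : 0 < Real.log 2 := Real.log_pos (by norm_num)
  -- The summand `K` of the constant `8 + K` absorbs `log 8` and `log 2`: indeed `log (1 / ε₀) ≤ log (1 / ε)`.
  set K := 4 * (Real.log 8 + Real.log 2) / Real.log (1 / ε₀) with hK
  have hK0 : 0 < K := by positivity
  refine ⟨8 + K, by positivity, ?_, 8 + K + 1, 1, ?_⟩
  · intro V _ _ G hW ε δ hε hεε₀ hδ hδ1 m hm
    have hε1 : ε < 1 := hεε₀.trans_lt hε₀'
    have hn := G.one_lt_card hW
    have hm0 : 0 < m := by
      have := CorrelationClustering.sampleBound_pos (c := 8 + K) (by positivity) hn hε hε1 hδ hδ1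
      exact_mod_cast this.trans_le hm
    refine G.prob_coreset_ge hW hm0 hε hε1.le hδ ?_
    have hd : (1 : ℝ) ≤ (Fintype.card V : ℝ) - 1 := by
      have : (2 : ℝ) ≤ Fintype.card V := by exact_mod_cast hn
      linarith
    have hD : 0 < Real.log (1 / δ) := Real.log_pos (one_lt_one_div hδ hδ1)
    have hL : Real.log (1 / ε₀) ≤ Real.log (1 / ε) :=
      Real.log_le_log (by positivity) (one_div_le_one_div_of_le hε hεε₀)
    unfold CorrelationClustering.sampleBound at hm
    rw [← mul_div_assoc, div_le_iff₀ (by positivity)] at hm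
    refine le_trans ?_ hm
    set d := (Fintype.card V : ℝ) - 1
    set L := Real.log (1 / ε)
    set D := Real.log (1 / δ)
    have h1 : 4 * (Real.log 8 + Real.log 2) ≤ K * L := by
      calc 4 * (Real.log 8 + Real.log 2) = K * Real.log (1 / ε₀) := by
            rw [hK, div_mul_cancel₀ _ hL0.ne']
        _ ≤ K * L := by gcongr
    have h2 : d * (4 * (Real.log 8 + Real.log 2)) ≤ d * (K * L) := by gcongr
    have h3 : Real.log 2 ≤ d * Real.log 2 := le_mul_of_one_le_left hl2.le hd
    have h4 : 0 < K * D := by positivity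
    linarith
  · intro n ε δ hn hε hεε₀ hδ hδ1
    rw [pow_one]
    exact CorrelationClustering.ceil_sampleBound_le (by positivity) hn hε (hεε₀.trans_lt hε₀')
      hδ hδ1
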